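/- Let $K\ge 1$ and consider the $K$-user real Gaussian interference channel $Y^{[k]}(t)=\sum_{j=1}^{K}H^{[kj]}X^{[j]}(t)+Z^{[k]}(t)$, $k=1,\dots,K$, with single-antenna nodes, constant real coefficients $H^{[kj]}$, no propagation delays, independent noise samples $Z^{[k]}(t)\sim\mathcal N(0,1)$, one independent message from transmitter $k$ to receiver $k$ for each $k$, and average transmit power at most $P$ at each transmitter. Let $C(P)$ be its sum capacity, i.e. the supremum of the sum rates that block codes achieve with error probability tending to $0$ as the block length grows. The channel is fully connected if all $H^{[kj]}$ are non-zero, and it achieves $d$ degrees of freedom if $\liminf_{P\to\infty}\frac{C(P)}{\frac12\log P}\ge d$ (rates and logarithm in the same unit). For every $\varepsilon>0$ there is a fully connected channel of this kind that achieves $\frac K2(1-\varepsilon)$ degrees of freedom. More precisely, for every integer multiple $Q$ of $K$ with $Q>K^{1/\varepsilon}$, the channel with $H^{[kk]}=1$ and $H^{[kj]}=Q^{-1}$ for $j\ne k$ is fully connected and achieves $\frac K2(1-\varepsilon)$ degrees of freedom. This holds even if all transmitted symbols are restricted to numbers of the form $\sum_{i=0}^{N-1}a_iQ^{2i}$ with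 $N\ge 0$ and $a_i\in\{0,1,\dots,\frac QK-1\}$, that is, base-$Q$ digits below $Q/K$ in the even positions only. If all transmitters send such symbols, the interference $\sum_{j\neq k}H^{[kj]}X^{[j]}$ at each receiver $k$ has the form $\sum_{i=0}^{N-1}b_iQ^{2i-1}$ with $N\ge 0$ and $b_i\in\{0,1,\dots,Q-1\}$, that is, it has no carry-overs and occupies the odd positions only. -/

import Mathlib

open MeasureTheory ProbabilityTheory Filter
open scoped BigOperators

/-- The vector of length `n` received at receiver `k` of the `K`-user real interference channel with
constant (time-invariant) single-antenna coefficients `H k j` (from transmitter `j` to receiver `k`),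
inputs `x j t` and noise `z k t`:  `Y k t = ∑ j, H k j * x j t + z k t`. -/
def received {K n : ℕ} (H : Matrix (Fin K) (Fin K) ℝ) (x z : Fin K → Fin n → ℝ)
    (k : Fin K) : Fin n → ℝ :=
  fun t => ∑ j, H k j * x j t + z k t

/-- The law of the noise over `n` channel uses: independent standard Gaussians, over all receivers
and all times. -/
noncomputable def noiseLaw (K n : ℕ) : Measure (Fin K → Fin n → ℝ) :=
  Measure.pi fun _ => Measure.pi fun _ => gaussianReal 0 1

/-- A block code of length `n` for the `K`-user interference channel: user `k` has one of `size k`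
messages, `enc k` is the encoder of transmitter `k` (which knows its own message only) and `dec k` is
the decoder of receiver `k` (which sees its own output only). -/
structure BlockCode (K n : ℕ) where
  size : Fin K → ℕ
  enc : (k : Fin K) → Fin (size k) → Fin n → ℝ
  dec : (k : Fin K) → (Fin n → ℝ) → Fin (size k)
  measurable_dec : ∀ k, Measurable (dec k)

namespace BlockCode

variable {K n : ℕ}

/-- Transmit power constraint `P` at each transmitter, for every codeword. -/
def MeetsPower (c : BlockCode K n) (P : ℝ) : Prop :=
  ∀ k w, ∑ t, c.enc k w t ^ 2 ≤ n * P

/-- All transmitted symbols lie in the set `S`. -/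
def UsesAlphabet (c : BlockCode K n) (S : Set ℝ) : Prop :=
  ∀ k w t, c.enc k w t ∈ S

/-- Probability, over independent uniform messages and over the noise, that some receiver does not
decode its own message correctly. -/
noncomputable def errorProb (c : BlockCode K n) (H : Matrix (Fin K) (Fin K) ℝ) : ℝ :=
  (∑ w : (k : Fin K) → Fin (c.size k),
      (noiseLaw K n).real
        {z | ∃ k, c.dec k (received H (fun j => c.enc j (w j)) z k) ≠ w k}) /
    ∏ k, (c.size k : ℝ)

end BlockCode

/-- The rate tuple `R` (in nats per channel use) is achievable over the channel `H` under the power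
constraint `P` with transmitted symbols in `S`. -/
def IsAchievable {K : ℕ} (H : Matrix (Fin K) (Fin K) ℝ) (S : Set ℝ) (P : ℝ)
    (R : Fin K → ℝ) : Prop :=
  (∀ k, 0 ≤ R k) ∧
    ∀ δ : ℝ, 0 < δ → ∀ᶠ n : ℕ in atTop, ∃ c : BlockCode K n,
      c.MeetsPower P ∧ c.UsesAlphabet S ∧
        (∀ k, Real.exp (n * R k) ≤ (c.size k : ℝ)) ∧ c.errorProb H ≤ δ

/-- Supremum of the achievable sum rates with transmitted symbols in `S`; for `S = Set.univ` this is
the sum capacity `C(P)` of the channel. -/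
noncomputable def sumCapacity {K : ℕ} (H : Matrix (Fin K) (Fin K) ℝ) (S : Set ℝ) (P : ℝ) : EReal :=
  ⨆ (R : Fin K → ℝ) (_ : IsAchievable H S P R), ((∑ k, R k : ℝ) : EReal)

/-- `d` degrees of freedom are achieved over the channel `H` with transmitted symbols in `S`:
`liminf C(P) / ((1/2) log P) ≥ d` as `P → ∞`. -/
def AchievesDoF {K : ℕ} (H : Matrix (Fin K) (Fin K) ℝ) (S : Set ℝ) (d : ℝ) : Prop :=
  (d : EReal) ≤
    liminf (fun P : ℝ => sumCapacity H S P / ((1 / 2 * Real.log P : ℝ) : EReal)) atTop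

/-- All channel coefficients are non-zero. -/
def IsFullyConnected {K : ℕ} (H : Matrix (Fin K) (Fin K) ℝ) : Prop :=
  ∀ k j, H k j ≠ 0

/-- Direct gains `1`, cross gains `Q⁻¹`. -/
noncomputable def alignmentChannel (K Q : ℕ) : Matrix (Fin K) (Fin K) ℝ :=
  fun k j => if j = k then 1 else (Q : ℝ)⁻¹

/-- Numbers whose base-`Q` digits lie in `{0, …, Q / K - 1}` and occupy only the even positions
`0, 2, …, 2N - 2` (used only when `K` divides `Q`). -/
def evenDigitSignals (K Q : ℕ) : Set ℝ :=
  {x | ∃ (N : ℕ) (a : ℕ → ℕ), (∀ i, a i < Q / K) ∧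
    x = ∑ i ∈ Finset.range N, (a i : ℝ) * (Q : ℝ) ^ (2 * i)}

/-- Numbers whose base-`Q` digits, in `{0, …, Q - 1}`, occupy only the odd positions
`-1, 1, …, 2N - 3`. -/
def oddDigitSignals (Q : ℕ) : Set ℝ :=
  {y | ∃ (N : ℕ) (b : ℕ → ℕ), (∀ i, b i < Q) ∧
    y = ∑ i ∈ Finset.range N, (b i : ℝ) * (Q : ℝ) ^ (2 * (i : ℤ) - 1)}

/-! The channel separates signal from interference by digit position in base `Q`. Every transmitter
uses even positions with digits below `Q / K`. The cross gain `Q⁻¹` shifts interference to odd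
positions, and `K - 1` such digits sum to less than `Q`, so nothing carries into the desired digits.

If the lowest `L + 1` even positions stay empty, the noiseless output is an integer multiple of `Q ^
(2 * L + 1)`. Rounding recovers the `N` desired digits unless the noise sample exceeds half that
spacing (`exists_digit_slicer`). For large `L` this is rare, and a Gilbert–Varshamov outer code over
the alphabet of digit vectors repairs the few bad symbols (`isAchievable_of_slicer`).

Power `P` allows `N ≈ log P / (4 log Q)` digits with `l`, `L` fixed, each worth `log (Q / K)`. Per
user this gives about `(1 - 3 / l) (1 - log K / log Q) / 2` degrees of freedom. Since `Q > K ^ (1 /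
ε)` means `log K < ε log Q` strictly, some finite `l` suffices. -/

/-! ### Codes in the Hamming metric. -/

theorem card_agree_off {ι A : Type*} [Fintype ι] [DecidableEq ι] [Fintype A] [DecidableEq A]
    (y : ι → A) (S : Finset ι) :
    (Finset.univ.filter fun x : ι → A => ∀ t, t ∉ S → x t = y t).card =
      Fintype.card A ^ S.card := by
  have : (Finset.univ.filter fun x : ι → A => ∀ t, t ∉ S → x t = y t) =
      Fintype.piFinset fun t => if t ∈ S then Finset.univ else {y t} := by
    ext x
    simp only [Finset.mem_filter, Finset.mem_univ, true_and, Fintype.mem_piFinset]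
    refine forall_congr' fun t => ?_
    by_cases h : t ∈ S <;> simp [h]
  rw [this, Fintype.card_piFinset]
  have h2 : ∀ t, (if t ∈ S then (Finset.univ : Finset A) else {y t}).card =
      if t ∈ S then Fintype.card A else 1 := by
    intro t; split_ifs <;> simp
  simp [h2, Finset.prod_ite_mem]

/-- Volume bound for Hamming balls. -/
theorem card_hammingBall_le {ι A : Type*} [Fintype ι] [DecidableEq ι] [Fintype A] [DecidableEq A]
    [Nonempty A] (y : ι → A) (r : ℕ) :
    (Finset.univ.filter fun x : ι → A => hammingDist x y ≤ r).card ≤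
      2 ^ Fintype.card ι * Fintype.card A ^ r := by
  -- Classify words by the set of places where they differ from `y`; there are at most `2 ^ n` such
  -- sets, where `n` is the word length.
  have hsub : (Finset.univ.filter fun x : ι → A => hammingDist x y ≤ r) ⊆
      (Finset.univ.filter fun S : Finset ι => S.card ≤ r).biUnion fun S =>
        Finset.univ.filter fun x : ι → A => ∀ t, t ∉ S → x t = y t := by
    intro x hx
    simp only [Finset.mem_filter, Finset.mem_univ, true_and, Finset.mem_biUnion] at hx ⊢
    exact ⟨Finset.univ.filter fun t => x t ≠ y t, hx, by simp⟩
  refine (Finset.card_le_card hsub).trans (Finset.card_biUnion_le.trans ?_)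
  have h1 : ∀ S ∈ (Finset.univ.filter fun S : Finset ι => S.card ≤ r),
      (Finset.univ.filter fun x : ι → A => ∀ t, t ∉ S → x t = y t).card ≤
        Fintype.card A ^ r := by
    intro S hS
    rw [card_agree_off]
    exact Nat.pow_le_pow_right Fintype.card_pos (by simpa using hS)
  refine (Finset.sum_le_card_nsmul _ _ _ h1).trans ?_
  rw [smul_eq_mul]
  refine Nat.mul_le_mul_right _ ?_
  refine (Finset.card_filter_le _ _).trans ?_
  simp

/-- Gilbert–Varshamov bound. -/
theorem exists_code_hammingDist {ι A : Type*} [Fintype ι] [DecidableEq ι] [Fintype A]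
    [DecidableEq A] [Nonempty A] (r : ℕ) :
    ∃ C : Finset (ι → A), (∀ x ∈ C, ∀ y ∈ C, x ≠ y → r < hammingDist x y) ∧
      Fintype.card A ^ Fintype.card ι ≤ C.card * (2 ^ Fintype.card ι * Fintype.card A ^ r) := by
  classical
  let F := (Finset.univ : Finset (Finset (ι → A))).filter
    fun C => ∀ x ∈ C, ∀ y ∈ C, x ≠ y → r < hammingDist x y
  obtain ⟨C, hC, hmax⟩ := Finset.exists_max_image F Finset.card ⟨∅, by simp [F]⟩
  have hC' : ∀ x ∈ C, ∀ y ∈ C, x ≠ y → r < hammingDist x y := by simpa [F] using hC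
  refine ⟨C, hC', ?_⟩
  -- By maximality the balls around `C` cover everything: an uncovered word could be added to `C`.
  have hcov : (Finset.univ : Finset (ι → A)) ⊆
      C.biUnion fun y => Finset.univ.filter fun x : ι → A => hammingDist x y ≤ r := by
    intro x _
    by_contra hx
    simp only [Finset.mem_biUnion, Finset.mem_filter, Finset.mem_univ, true_and, not_exists,
      not_and, not_le] at hx
    have hxC : x ∉ C := fun h => by simpa using hx x h
    have hins : insert x C ∈ F := by
      simp only [F, Finset.mem_filter, Finset.mem_univ, true_and, Finset.mem_insert]
      rintro u (rfl | hu) v (rfl | hv) huv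
      · exact absurd rfl huv
      · exact hx v hv
      · rw [hammingDist_comm]; exact hx u hu
      · exact hC' u hu v hv huv
    have := hmax _ hins
    rw [Finset.card_insert_of_notMem hxC] at this
    omega
  have := (Finset.card_le_card hcov).trans (Finset.card_biUnion_le.trans
    (Finset.sum_le_card_nsmul _ _ _ fun y _ => card_hammingBall_le y r))
  simpa using this

/-- Nearest-codeword decoding corrects fewer than `m` errors when distinct codewords differ in
more than `2 * m` places. -/
theorem exists_unique_decoder {ι A : Type*} [Fintype ι] [DecidableEq A] {M : ℕ} [NeZero M]
    (e : Fin M → ι → A) {m : ℕ} (he : ∀ u v, u ≠ v → 2 * m < hammingDist (e u) (e v)) :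
    ∃ D : (ι → A) → Fin M, ∀ w x, hammingDist x (e w) < m → D x = w := by
  classical
  refine ⟨fun x => if h : ∃ w, hammingDist x (e w) < m then h.choose else 0, fun w x hx => ?_⟩
  have h : ∃ w, hammingDist x (e w) < m := ⟨w, hx⟩
  simp only [h, dif_pos]
  by_contra hne
  have h1 := he _ _ hne
  have h2 := h.choose_spec
  have h3 := hammingDist_triangle (e h.choose) x (e w)
  rw [hammingDist_comm (e h.choose) x] at h3
  omega

/-! ### Gaussian noise. -/

/-- The probability that at least `m` of the noise samples at receiver `k` have magnitude at least
`T` is at most `2 ^ n * p ^ m`, where `p` is the tail probability of one sample. -/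
theorem noiseLaw_many_large_le {K n : ℕ} (k : Fin K) (m : ℕ) (T : ℝ) :
    (noiseLaw K n).real {z | m ≤ (Finset.univ.filter fun t => T ≤ |z k t|).card} ≤
      2 ^ n * (gaussianReal 0 1).real {x | T ≤ |x|} ^ m := by
  classical
  have hprob : IsProbabilityMeasure (noiseLaw K n) := by unfold noiseLaw; infer_instance
  have hsub : {z : Fin K → Fin n → ℝ | m ≤ (Finset.univ.filter fun t => T ≤ |z k t|).card} ⊆
      ⋃ S ∈ (Finset.univ.filter fun S : Finset (Fin n) => S.card = m),
        {z | ∀ t ∈ S, T ≤ |z k t|} := by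
    intro z hz
    obtain ⟨S, hS, hSm⟩ := Finset.exists_subset_card_eq hz
    simp only [Finset.mem_filter, Finset.mem_univ, true_and, Set.mem_iUnion]
    exact ⟨S, hSm, fun t ht => by simpa using hS ht⟩
  have hS : ∀ S ∈ (Finset.univ.filter fun S : Finset (Fin n) => S.card = m),
      (noiseLaw K n).real {z | ∀ t ∈ S, T ≤ |z k t|} ≤
        (gaussianReal 0 1).real {x | T ≤ |x|} ^ m := by
    intro S hS
    have hSm : S.card = m := by simpa using hS
    have heq : {z : Fin K → Fin n → ℝ | ∀ t ∈ S, T ≤ |z k t|} =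
        Set.pi Set.univ fun j => if j = k then
          (Set.pi Set.univ fun t => if t ∈ S then {x : ℝ | T ≤ |x|} else Set.univ)
          else Set.univ := by
      ext z
      simp only [Set.mem_ofPred_eq, Set.mem_pi, Set.mem_univ, true_imp_iff]
      constructor
      · intro h j
        split_ifs with hj
        · subst hj
          intro t _
          beta_reduce
          split_ifs with ht
          · exact h t ht
          · trivial
        · trivial
      · intro h t ht
        have := h k
        rw [if_pos rfl] at this
        have := this t (Set.mem_univ _)
        beta_reduce at this
        rwa [if_pos ht] at this
    refine le_of_eq ?_
    rw [heq, measureReal_def, noiseLaw, Measure.pi_pi]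
    have h1 : ∀ j : Fin K, (Measure.pi fun _ : Fin n => gaussianReal 0 1) (if j = k then
          (Set.pi Set.univ fun t => if t ∈ S then {x : ℝ | T ≤ |x|} else Set.univ)
          else Set.univ) = if j = k then (gaussianReal 0 1 {x | T ≤ |x|}) ^ m else 1 := by
      intro j
      split_ifs
      · rw [Measure.pi_pi]
        have h2 : ∀ t, gaussianReal 0 1 (if t ∈ S then {x : ℝ | T ≤ |x|} else Set.univ) =
            if t ∈ S then gaussianReal 0 1 {x : ℝ | T ≤ |x|} else 1 := by
          intro t; split_ifs <;> simp
        simp only [h2, Finset.prod_ite_mem, Finset.univ_inter, Finset.prod_const, hSm]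
      · exact measure_univ
    simp only [h1, Finset.prod_ite_eq', Finset.mem_univ, if_true, ENNReal.toReal_pow]
    rfl
  refine (measureReal_mono hsub (measure_ne_top _ _)).trans ((measureReal_biUnion_finset_le _ _).trans
    ((Finset.sum_le_card_nsmul _ _ _ hS).trans ?_))
  rw [nsmul_eq_mul]
  refine mul_le_mul_of_nonneg_right ?_ (by positivity)
  have := Finset.card_filter_le (Finset.univ : Finset (Finset (Fin n))) fun S => S.card = m
  calc _ ≤ (((Finset.univ : Finset (Finset (Fin n))).card : ℕ) : ℝ) := by exact_mod_cast this
    _ = 2 ^ n := by simp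

/-- Continuity from above: the tail sets decrease to the empty set. -/
theorem tendsto_gaussian_tail :
    Tendsto (fun T : ℝ => (gaussianReal 0 1).real {x | T ≤ |x|}) atTop (nhds 0) := by
  have h := tendsto_measure_iInter_atTop (μ := gaussianReal 0 1)
    (s := fun T : ℝ => {x : ℝ | T ≤ |x|})
    (fun T => (measurableSet_le measurable_const measurable_id.abs).nullMeasurableSet)
    (fun a b hab x hx => le_trans hab hx) ⟨0, measure_ne_top _ _⟩
  have he : (⋂ T : ℝ, {x : ℝ | T ≤ |x|}) = ∅ := by
    ext x
    simp only [Set.mem_iInter, Set.mem_ofPred_eq, Set.mem_empty_iff_false, iff_false, not_forall,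
      not_le]
    exact ⟨|x| + 1, by linarith⟩
  rw [he, measure_empty] at h
  exact (ENNReal.tendsto_toReal ENNReal.zero_ne_top).comp h

/-! ### Digit expansions and carry-free interference. -/

theorem sum_digit_mul_pow_lt {N q : ℕ} (c : Fin N → ℕ) (hc : ∀ i, c i < q) :
    ∑ i, c i * q ^ (i : ℕ) < q ^ N := by
  have := (finFunctionFinEquiv fun i => (⟨c i, hc i⟩ : Fin q)).2
  rwa [finFunctionFinEquiv_apply] at this

theorem digits_eq_of_sum_eq {N q : ℕ} {c d : Fin N → ℕ} (hc : ∀ i, c i < q) (hd : ∀ i, d i < q)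
    (h : ∑ i, c i * q ^ (i : ℕ) = ∑ i, d i * q ^ (i : ℕ)) : c = d := by
  have : finFunctionFinEquiv (fun i => (⟨c i, hc i⟩ : Fin q)) =
      finFunctionFinEquiv fun i => (⟨d i, hd i⟩ : Fin q) := by
    apply Fin.ext
    simpa only [finFunctionFinEquiv_apply] using h
  have := finFunctionFinEquiv.injective this
  funext i
  simpa using congrArg Fin.val (congrFun this i)

/-- Adding `K - 1` digits below `Q / K` produces no carry-over in base `Q`. -/
theorem sum_erase_digit_lt {K Q : ℕ} (hb : 0 < Q / K) (k : Fin K) (a : Fin K → ℕ)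
    (ha : ∀ j, a j < Q / K) : ∑ j ∈ Finset.univ.erase k, a j < Q := by
  have hK : 0 < K := k.pos
  have h1 : ∑ j ∈ Finset.univ.erase k, a j ≤ (K - 1) * (Q / K) := by
    have := Finset.sum_le_card_nsmul (Finset.univ.erase k) a (Q / K) fun j _ => (ha j).le
    simpa using this
  have h2 : (K - 1) * (Q / K) < K * (Q / K) := Nat.mul_lt_mul_of_pos_right (by omega) hb
  exact h1.trans_lt (h2.trans_le (Nat.mul_div_le Q K))

theorem interference_mem_oddDigitSignals {K Q : ℕ} (hb : 0 < Q / K) (x : Fin K → ℝ)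
    (hx : ∀ j, x j ∈ evenDigitSignals K Q) (k : Fin K) :
    ∑ j ∈ Finset.univ.erase k, alignmentChannel K Q k j * x j ∈ oddDigitSignals Q := by
  have hQ : (Q : ℝ) ≠ 0 := by
    rintro h
    have : Q = 0 := by exact_mod_cast h
    simp [this] at hb
  choose N a ha hxa using hx
  -- Pad with zero digits so that all users share the length `M`.
  let a' : Fin K → ℕ → ℕ := fun j i => if i < N j then a j i else 0
  have ha' : ∀ j i, a' j i < Q / K := by
    intro j i
    simp only [a']
    split_ifs
    · exact ha j i
    · exact hb
  let M := Finset.univ.sup N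
  refine ⟨M, fun i => ∑ j ∈ Finset.univ.erase k, a' j i,
    fun i => sum_erase_digit_lt hb k _ fun j => ha' j i, ?_⟩
  have hxM : ∀ j, x j = ∑ i ∈ Finset.range M, (a' j i : ℝ) * (Q : ℝ) ^ (2 * i) := by
    intro j
    rw [hxa j]
    have hsub : Finset.range (N j) ⊆ Finset.range M :=
      Finset.range_subset_range.2 (Finset.le_sup (f := N) (Finset.mem_univ j))
    rw [← Finset.sum_subset hsub]
    · refine Finset.sum_congr rfl fun i hi => ?_
      simp [a', Finset.mem_range.1 hi]
    · intro i _ hi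
      have : ¬ i < N j := by simpa using hi
      simp [a', this]
  calc ∑ j ∈ Finset.univ.erase k, alignmentChannel K Q k j * x j
      = ∑ j ∈ Finset.univ.erase k, ∑ i ∈ Finset.range M,
          (a' j i : ℝ) * (Q : ℝ) ^ (2 * (i : ℤ) - 1) := by
        refine Finset.sum_congr rfl fun j hj => ?_
        rw [alignmentChannel, if_neg (Finset.ne_of_mem_erase hj), hxM j, Finset.mul_sum]
        refine Finset.sum_congr rfl fun i _ => ?_
        rw [zpow_sub_one₀ hQ, show (2 * (i : ℤ)) = ((2 * i : ℕ) : ℤ) by push_cast; ring,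
          zpow_natCast]
        ring
    _ = _ := by
        rw [Finset.sum_comm]
        refine Finset.sum_congr rfl fun i _ => ?_
        push_cast
        rw [Finset.sum_mul]

/-! ### Signals above the noise floor and their recovery. -/

/-- The signal with digits `a` in the even positions `2 * (L + 1), …, 2 * (L + N)`, the lower
positions being empty. -/
noncomputable def digitSignal (K Q L : ℕ) {N : ℕ} (a : Fin N → Fin (Q / K)) : ℝ :=
  ((Q ^ (2 * (L + 1)) * ∑ i, (a i : ℕ) * (Q ^ 2) ^ (i : ℕ) : ℕ) : ℝ)

theorem digitSignal_mem_evenDigitSignals {K Q : ℕ} (hb : 0 < Q / K) (L : ℕ) {N : ℕ}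
    (a : Fin N → Fin (Q / K)) : digitSignal K Q L a ∈ evenDigitSignals K Q := by
  let d : ℕ → ℕ := fun i => if h : L + 1 ≤ i ∧ i - (L + 1) < N then a ⟨i - (L + 1), h.2⟩ else 0
  refine ⟨L + 1 + N, d, fun i => ?_, ?_⟩
  · simp only [d]
    split_ifs
    · exact (a _).2
    · exact hb
  · rw [Finset.sum_range_add]
    have h0 : ∑ i ∈ Finset.range (L + 1), (d i : ℝ) * (Q : ℝ) ^ (2 * i) = 0 := by
      refine Finset.sum_eq_zero fun i hi => ?_
      have : ¬ (L + 1 ≤ i ∧ i - (L + 1) < N) := fun h => by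
        have := Finset.mem_range.1 hi
        omega
      simp only [d, dif_neg this, Nat.cast_zero, zero_mul]
    rw [h0, zero_add, Finset.sum_range, digitSignal]
    push_cast
    rw [Finset.mul_sum]
    refine Finset.sum_congr rfl fun i _ => ?_
    have : d (L + 1 + i) = a i := by
      have h : L + 1 ≤ L + 1 + (i : ℕ) ∧ L + 1 + (i : ℕ) - (L + 1) < N := ⟨by omega, by omega⟩
      simp only [d, dif_pos h, Nat.add_sub_cancel_left]
    rw [this]
    ring

theorem digitSignal_sq_le {K Q : ℕ} (L : ℕ) {N : ℕ} (a : Fin N → Fin (Q / K)) :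
    digitSignal K Q L a ^ 2 ≤ (Q : ℝ) ^ (4 * (L + 1 + N)) := by
  have h1 := sum_digit_mul_pow_lt (q := Q ^ 2) (fun i => (a i : ℕ)) fun i =>
    (a i).2.trans_le ((Nat.div_le_self Q K).trans (Nat.le_self_pow two_ne_zero Q))
  have h2 : digitSignal K Q L a ≤ (Q : ℝ) ^ (2 * (L + 1 + N)) := by
    have : Q ^ (2 * (L + 1)) * ∑ i, (a i : ℕ) * (Q ^ 2) ^ (i : ℕ) ≤ Q ^ (2 * (L + 1 + N)) := by
      calc _ ≤ Q ^ (2 * (L + 1)) * (Q ^ 2) ^ N := Nat.mul_le_mul_left _ h1.le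
        _ = _ := by ring
    unfold digitSignal
    exact_mod_cast this
  calc digitSignal K Q L a ^ 2 ≤ ((Q : ℝ) ^ (2 * (L + 1 + N))) ^ 2 :=
        pow_le_pow_left₀ (by unfold digitSignal; positivity) h2 2
    _ = _ := by ring

/-- Symbolwise decisions at the receivers: the desired digits are recovered whenever the noise is
smaller than half of the lowest interference level. -/
theorem exists_digit_slicer {K Q : ℕ} (hb : 0 < Q / K) (L N : ℕ) :
    ∃ s : ℝ → Fin N → Fin (Q / K), Measurable s ∧
      ∀ (k : Fin K) (a : Fin K → Fin N → Fin (Q / K)) (z : ℝ),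
        |z| < (Q : ℝ) ^ (2 * L + 1) / 2 →
          s (∑ j, alignmentChannel K Q k j * digitSignal K Q L (a j) + z) = a k := by
  classical
  have hQ : 0 < Q := Nat.pos_of_ne_zero fun h => by simp [h] at hb
  have hQR : (0 : ℝ) < Q := by exact_mod_cast hQ
  let I : Fin K → (Fin K → Fin N → Fin (Q / K)) → Fin N → ℕ :=
    fun k a i => ∑ j ∈ Finset.univ.erase k, (a j i : ℕ)
  have hI : ∀ k a i, I k a i < Q := fun k a i => sum_erase_digit_lt hb k _ fun j => (a j i).2
  -- The noiseless output in units of `Q ^ (2 * L + 1)`. Each base-`Q ^ 2` digit packs a desired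
  -- digit above an interference digit, so division by `Q` isolates the former.
  let V : Fin K → (Fin K → Fin N → Fin (Q / K)) → ℕ :=
    fun k a => ∑ i, (Q * a k i + I k a i) * (Q ^ 2) ^ (i : ℕ)
  have hlt : ∀ k a i, Q * (a k i : ℕ) + I k a i < Q ^ 2 := by
    intro k a i
    have h1 : (a k i : ℕ) + 1 ≤ Q := (a k i).2.trans_le (Nat.div_le_self Q K)
    have h2 := hI k a i
    nlinarith
  have hinj : ∀ k a k' a', V k a = V k' a' → a k = a' k' := by
    intro k a k' a' h
    have := digits_eq_of_sum_eq (hlt k a) (hlt k' a') h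
    funext i
    apply Fin.ext
    have h1 := congrArg (· / Q) (congrFun this i)
    simpa [Nat.mul_add_div hQ, Nat.div_eq_of_lt (hI _ _ _)] using h1
  -- Well defined on values of `V` by `hinj`, even across receivers; the zero vector elsewhere is
  -- arbitrary.
  let D : ℤ → Fin N → Fin (Q / K) := fun v =>
    if h : ∃ p : Fin K × (Fin K → Fin N → Fin (Q / K)), (V p.1 p.2 : ℤ) = v
      then h.choose.2 h.choose.1 else fun _ => ⟨0, hb⟩
  have hD : ∀ k a, D (V k a) = a k := by
    intro k a
    have h : ∃ p : Fin K × (Fin K → Fin N → Fin (Q / K)), (V p.1 p.2 : ℤ) = V k a := ⟨(k, a), rfl⟩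
    simp only [D, dif_pos h]
    exact hinj _ _ _ _ (by exact_mod_cast h.choose_spec)
  have hg : (0 : ℝ) < (Q : ℝ) ^ (2 * L + 1) := by positivity
  -- Adding `1 / 2` before the floor rounds to the nearest integer.
  refine ⟨fun y => D ⌊y / (Q : ℝ) ^ (2 * L + 1) + 1 / 2⌋, ?_, ?_⟩
  · exact (measurable_of_countable D).comp
      (Int.measurable_floor.comp ((measurable_id.div_const _).add_const _))
  · intro k a z hz
    have hsum : ∑ j, alignmentChannel K Q k j * digitSignal K Q L (a j) =
        (Q : ℝ) ^ (2 * L + 1) * V k a := by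
      rw [← Finset.add_sum_erase _ _ (Finset.mem_univ k)]
      have h1 : ∑ j ∈ Finset.univ.erase k, alignmentChannel K Q k j * digitSignal K Q L (a j) =
          (Q : ℝ) ^ (2 * L + 1) * ∑ i, (I k a i : ℝ) * ((Q : ℝ) ^ 2) ^ (i : ℕ) := by
        simp only [I, Nat.cast_sum, Finset.sum_mul]
        rw [Finset.sum_comm, Finset.mul_sum]
        refine Finset.sum_congr rfl fun j hj => ?_
        rw [alignmentChannel, if_neg (Finset.ne_of_mem_erase hj), digitSignal]
        push_cast
        rw [show 2 * (L + 1) = (2 * L + 1) + 1 by ring, pow_succ (Q : ℝ) (2 * L + 1)]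
        field_simp
      rw [h1, alignmentChannel, if_pos rfl, one_mul, digitSignal]
      simp only [V]
      push_cast
      simp only [add_mul, Finset.sum_add_distrib, mul_add, mul_assoc, ← Finset.mul_sum]
      ring
    have hfl : ⌊(∑ j, alignmentChannel K Q k j * digitSignal K Q L (a j) + z) /
        (Q : ℝ) ^ (2 * L + 1) + 1 / 2⌋ = (V k a : ℤ) := by
      rw [hsum, Int.floor_eq_iff, add_div, mul_div_cancel_left₀ _ hg.ne']
      obtain ⟨hz1, hz2⟩ := abs_lt.1 hz
      have h1 : -(1 / 2) < z / (Q : ℝ) ^ (2 * L + 1) := by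
        rw [lt_div_iff₀ hg]; linarith
      have h2 : z / (Q : ℝ) ^ (2 * L + 1) < 1 / 2 := by
        rw [div_lt_iff₀ hg]; linarith
      push_cast
      constructor <;> linarith
    simp only [hfl, hD]

/-! ### Achievable rates and outer coding. -/

theorem IsAchievable.mono {K : ℕ} {H : Matrix (Fin K) (Fin K) ℝ} {S S' : Set ℝ} (hS : S ⊆ S')
    {P : ℝ} {R : Fin K → ℝ} (h : IsAchievable H S P R) : IsAchievable H S' P R := by
  refine ⟨h.1, fun δ hδ => (h.2 δ hδ).mono fun n => ?_⟩
  rintro ⟨c, h1, h2, h3⟩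
  exact ⟨c, h1, fun k w t => hS (h2 k w t), h3⟩

theorem BlockCode.errorProb_le {K n : ℕ} (c : BlockCode K n) (H : Matrix (Fin K) (Fin K) ℝ)
    {η : ℝ} (hη : 0 ≤ η)
    (h : ∀ w : (k : Fin K) → Fin (c.size k), (noiseLaw K n).real
      {z | ∃ k, c.dec k (received H (fun j => c.enc j (w j)) z k) ≠ w k} ≤ η) :
    c.errorProb H ≤ η := by
  unfold BlockCode.errorProb
  refine div_le_of_le_mul₀ (by positivity) hη ?_
  refine (Finset.sum_le_card_nsmul _ _ _ fun w _ => h w).trans (le_of_eq ?_)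
  simp [mul_comm]

theorem isAchievable_zero {K : ℕ} (H : Matrix (Fin K) (Fin K) ℝ) {S : Set ℝ} (hS : (0 : ℝ) ∈ S)
    {P : ℝ} (hP : 0 ≤ P) : IsAchievable H S P fun _ => 0 := by
  refine ⟨fun _ => le_rfl, fun δ hδ => Eventually.of_forall fun n => ?_⟩
  refine ⟨⟨fun _ => 1, fun _ _ _ => 0, fun _ _ => 0, fun _ => measurable_const⟩, ?_, ?_, ?_, ?_⟩
  · intro k w
    simp only [ne_eq, OfNat.ofNat_ne_zero, not_false_eq_true, zero_pow, Finset.sum_const_zero]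
    positivity
  · exact fun _ _ _ => hS
  · simp
  · refine BlockCode.errorProb_le _ _ hδ.le fun w => ?_
    have : {z : Fin K → Fin n → ℝ | ∃ k, (0 : Fin 1) ≠ w k} = ∅ := by
      ext z
      simp only [Set.mem_ofPred_eq, Set.mem_empty_iff_false, iff_false, not_exists, not_not]
      exact fun k => Subsingleton.elim _ _
    exact (congrArg _ this).trans_le (by simpa using hδ.le)

/-- Outer coding: if the symbols of a finite alphabet `A` are recovered at every receiver whenever
the noise sample is smaller than `T`, and large noise samples are rare, then the rate
`(1 - 3 / l) * log |A| - log 2` is achievable for every user. -/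
theorem isAchievable_of_slicer {K : ℕ} (H : Matrix (Fin K) (Fin K) ℝ) {S : Set ℝ} {P T : ℝ}
    {A : Type*} [Fintype A] [DecidableEq A] [Nonempty A] [MeasurableSpace A]
    [MeasurableSingletonClass A] (σ : A → ℝ) (hσ : ∀ a, σ a ∈ S) (hP : ∀ a, σ a ^ 2 ≤ P)
    (s : ℝ → A) (hs : Measurable s)
    (hdec : ∀ (k : Fin K) (a : Fin K → A) (z : ℝ), |z| < T → s (∑ j, H k j * σ (a j) + z) = a k)
    {l : ℕ} (hl : 0 < l) (hT : (gaussianReal 0 1).real {x | T ≤ |x|} ≤ (1 / 4) ^ l)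
    (hR : 0 ≤ (1 - 3 / (l : ℝ)) * Real.log (Fintype.card A) - Real.log 2) :
    IsAchievable H S P fun _ => (1 - 3 / (l : ℝ)) * Real.log (Fintype.card A) - Real.log 2 := by
  refine ⟨fun _ => hR, fun δ hδ => ?_⟩
  have hlim : Tendsto (fun n : ℕ => (K : ℝ) * (1 / 2) ^ n) atTop (nhds 0) := by
    simpa using (tendsto_pow_atTop_nhds_zero_of_lt_one (r := (1 / 2 : ℝ)) (by norm_num)
      (by norm_num)).const_mul (K : ℝ)
  filter_upwards [hlim.eventually_le_const hδ, eventually_ge_atTop (2 * l)] with n hn hnl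
  -- This gives `n ≤ l * m`, for the error bound, and `2 * m ≤ 3 * n / l` once `n ≥ 2 * l`, for the
  -- rate.
  set m := n / l + 1 with hm
  have hlm : n ≤ l * m := by
    have := Nat.lt_mul_div_succ n hl
    exact this.le
  obtain ⟨C, hCd, hCc⟩ := exists_code_hammingDist (ι := Fin n) (A := A) (2 * m)
  have hApos : 0 < Fintype.card A := Fintype.card_pos
  have hC0 : 0 < C.card := by
    refine Nat.pos_of_ne_zero fun h => ?_
    rw [h, zero_mul] at hCc
    exact absurd hCc (by simp)
  have : NeZero C.card := ⟨hC0.ne'⟩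
  let e : Fin C.card → Fin n → A := fun w => (C.equivFin.symm w : Fin n → A)
  have he : ∀ u v, u ≠ v → 2 * m < hammingDist (e u) (e v) := by
    intro u v huv
    refine hCd _ (C.equivFin.symm u).2 _ (C.equivFin.symm v).2 fun h => huv ?_
    exact C.equivFin.symm.injective (Subtype.ext h)
  obtain ⟨D, hD⟩ := exists_unique_decoder e he
  let c : BlockCode K n :=
    { size := fun _ => C.card
      enc := fun _ w t => σ (e w t)
      dec := fun _ y => D fun t => s (y t)
      measurable_dec := fun _ => (measurable_of_countable D).comp
        (measurable_pi_lambda _ fun t => hs.comp (measurable_pi_apply t)) }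
  refine ⟨c, ?_, fun _ _ _ => hσ _, fun _ => ?_, ?_⟩
  · intro k w
    refine (Finset.sum_le_card_nsmul _ _ P fun t _ => hP _).trans (le_of_eq ?_)
    simp
  · change Real.exp _ ≤ (C.card : ℝ)
    have hC0R : (0 : ℝ) < C.card := by exact_mod_cast hC0
    rw [← Real.le_log_iff_exp_le hC0R]
    have hAR : (0 : ℝ) < Fintype.card A := by exact_mod_cast hApos
    have hlog : 0 ≤ Real.log (Fintype.card A) := Real.log_natCast_nonneg _
    have h1 : ((Fintype.card A : ℝ)) ^ n ≤ C.card * (2 ^ n * (Fintype.card A : ℝ) ^ (2 * m)) := by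
      have : Fintype.card A ^ n ≤ C.card * (2 ^ n * Fintype.card A ^ (2 * m)) := by
        simpa using hCc
      exact_mod_cast this
    have h2 := Real.log_le_log (by positivity) h1
    rw [Real.log_mul (by positivity) (by positivity), Real.log_mul (by positivity) (by positivity),
      Real.log_pow, Real.log_pow, Real.log_pow] at h2
    have hlR : (0 : ℝ) < l := by exact_mod_cast hl
    have hm1 : ((2 * m : ℕ) : ℝ) ≤ 3 / (l : ℝ) * n := by
      have h3 : ((n / l : ℕ) : ℝ) ≤ n / l := Nat.cast_div_le
      have h4 : (2 : ℝ) ≤ n / l := by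
        rw [le_div_iff₀ hlR]
        exact_mod_cast hnl
      rw [hm]
      push_cast
      have : 3 / (l : ℝ) * n = 3 * (n / l) := by ring
      rw [this]
      linarith
    have h5 := mul_le_mul_of_nonneg_right hm1 hlog
    linarith
  · refine BlockCode.errorProb_le _ _ hδ.le fun w => le_trans ?_ hn
    have hprob : IsProbabilityMeasure (noiseLaw K n) := by unfold noiseLaw; infer_instance
    -- A symbol is misread only under large noise, so a decoding failure needs at least `m` large
    -- samples at some receiver.
    have hsub : {z : Fin K → Fin n → ℝ |
          ∃ k, c.dec k (received H (fun j => c.enc j (w j)) z k) ≠ w k} ⊆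
        ⋃ k, {z | m ≤ (Finset.univ.filter fun t => T ≤ |z k t|).card} := by
      rintro z ⟨k, hk⟩
      refine Set.mem_iUnion.2 ⟨k, ?_⟩
      by_contra hlt
      refine hk (hD _ _ (lt_of_le_of_lt (Finset.card_le_card ?_) (not_le.1 hlt)))
      intro t ht
      simp only [Finset.mem_filter, Finset.mem_univ, true_and] at ht ⊢
      by_contra hz
      exact ht (hdec k (fun j => e (w j) t) (z k t) (not_le.1 hz))
    have hterm : ∀ k : Fin K, (noiseLaw K n).real
        {z | m ≤ (Finset.univ.filter fun t => T ≤ |z k t|).card} ≤ (1 / 2) ^ n := by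
      intro k
      refine (noiseLaw_many_large_le k m T).trans ?_
      calc (2 : ℝ) ^ n * (gaussianReal 0 1).real {x | T ≤ |x|} ^ m
          ≤ 2 ^ n * ((1 / 4) ^ l) ^ m := by
            gcongr
        _ ≤ 2 ^ n * (1 / 4) ^ n := by
            rw [← pow_mul]
            gcongr ?_ * ?_
            exact pow_le_pow_of_le_one (by norm_num) (by norm_num) hlm
        _ = (1 / 2) ^ n := by rw [← mul_pow]; norm_num
    refine (measureReal_mono hsub (measure_ne_top _ _)).trans
      ((measureReal_iUnion_fintype_le _).trans ?_)
    refine (Finset.sum_le_card_nsmul _ _ _ fun k _ => hterm k).trans (le_of_eq ?_)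
    simp

/-! ### From rates to degrees of freedom. -/

theorem AchievesDoF.of_eventually {K : ℕ} {H : Matrix (Fin K) (Fin K) ℝ} {S : Set ℝ} {d : ℝ}
    (h : ∀ᶠ P : ℝ in atTop, ∃ R, IsAchievable H S P R ∧ d * (1 / 2 * Real.log P) ≤ ∑ k, R k) :
    AchievesDoF H S d := by
  refine le_liminf_of_le (by isBoundedDefault) ?_
  filter_upwards [h, eventually_gt_atTop 1] with P ⟨R, hR, hd⟩ hP
  have hlog : 0 < 1 / 2 * Real.log P := by have := Real.log_pos hP; positivity
  rw [EReal.le_div_iff_mul_le (by exact_mod_cast hlog) (EReal.coe_ne_top _)]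
  refine le_trans ?_ (le_iSup₂_of_le R hR le_rfl)
  rw [← EReal.coe_mul]
  exact_mod_cast hd

theorem AchievesDoF.mono {K : ℕ} {H : Matrix (Fin K) (Fin K) ℝ} {S S' : Set ℝ} (hS : S ⊆ S')
    {d : ℝ} (h : AchievesDoF H S d) : AchievesDoF H S' d := by
  refine h.trans (liminf_le_liminf ?_ (by isBoundedDefault) (by isBoundedDefault))
  filter_upwards [eventually_gt_atTop 1] with P hP
  have hlog : 0 ≤ 1 / 2 * Real.log P := by have := Real.log_pos hP; positivity
  refine EReal.div_le_div_right_of_nonneg (by exact_mod_cast hlog) ?_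
  exact iSup₂_le fun R hR => le_iSup₂_of_le R (hR.mono hS) le_rfl

theorem achievesDoF_of_nonpos {K : ℕ} (H : Matrix (Fin K) (Fin K) ℝ) {S : Set ℝ}
    (hS : (0 : ℝ) ∈ S) {d : ℝ} (hd : d ≤ 0) : AchievesDoF H S d := by
  refine AchievesDoF.of_eventually ?_
  filter_upwards [eventually_gt_atTop 1] with P hP
  refine ⟨fun _ => 0, isAchievable_zero H hS (by linarith), ?_⟩
  have := Real.log_pos hP
  simpa using mul_nonpos_of_nonpos_of_nonneg hd (by positivity : 0 ≤ 1 / 2 * Real.log P)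

/-! ### The alignment channel. -/

theorem alignmentChannel_isAchievable {K Q : ℕ} (hb : 0 < Q / K) {l L N : ℕ} (hl : 0 < l)
    (hT : (gaussianReal 0 1).real {x | (Q : ℝ) ^ (2 * L + 1) / 2 ≤ |x|} ≤ (1 / 4) ^ l)
    {P : ℝ} (hP : (Q : ℝ) ^ (4 * (L + 1 + N)) ≤ P)
    (hR : 0 ≤ (1 - 3 / (l : ℝ)) * (N * Real.log ((Q / K : ℕ) : ℝ)) - Real.log 2) :
    IsAchievable (alignmentChannel K Q) (evenDigitSignals K Q) P
      fun _ => (1 - 3 / (l : ℝ)) * (N * Real.log ((Q / K : ℕ) : ℝ)) - Real.log 2 := by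
  have : Nonempty (Fin (Q / K)) := ⟨⟨0, hb⟩⟩
  obtain ⟨s, hs, hdec⟩ := exists_digit_slicer (K := K) hb L N
  have hcard : Real.log (Fintype.card (Fin N → Fin (Q / K))) =
      N * Real.log ((Q / K : ℕ) : ℝ) := by
    rw [Fintype.card_pi_const, Fintype.card_fin, Nat.cast_pow, Real.log_pow]
  rw [← hcard] at hR ⊢
  exact isAchievable_of_slicer _ (digitSignal K Q L) (digitSignal_mem_evenDigitSignals hb L)
    (fun a => (digitSignal_sq_le L a).trans hP) s hs hdec hl hT hR

theorem alignmentChannel_achievesDoF {K Q : ℕ} (hb : 0 < Q / K) (hQ : 1 < Q) {e : ℝ}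
    (he : 0 < e) (heQ : e * Real.log Q < Real.log ((Q / K : ℕ) : ℝ)) :
    AchievesDoF (alignmentChannel K Q) (evenDigitSignals K Q) (K / 2 * e) := by
  have hQR : (1 : ℝ) < Q := by exact_mod_cast hQ
  set q := Real.log Q with hq
  set β := Real.log ((Q / K : ℕ) : ℝ) with hβ
  have hq0 : 0 < q := Real.log_pos hQR
  have hβ0 : 0 < β := (mul_pos he hq0).trans heQ
  -- The strict slack in `heQ` absorbs the coding loss `3 / l`; then `L` is chosen from `l`, and
  -- both stay fixed as `P` grows.
  obtain ⟨l, hl0, hl⟩ : ∃ l : ℕ, 0 < l ∧ e * q < (1 - 3 / (l : ℝ)) * β := by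
    have h1 : Tendsto (fun l : ℕ => (1 - 3 / (l : ℝ)) * β) atTop (nhds ((1 - 0) * β)) :=
      (tendsto_const_nhds.sub (tendsto_const_div_atTop_nhds_zero_nat 3)).mul_const β
    rw [sub_zero, one_mul] at h1
    obtain ⟨l, h⟩ := ((h1.eventually_const_lt heQ).and (eventually_gt_atTop 0)).exists
    exact ⟨l, h.2, h.1⟩
  obtain ⟨L, hL⟩ : ∃ L : ℕ,
      (gaussianReal 0 1).real {x | (Q : ℝ) ^ (2 * L + 1) / 2 ≤ |x|} ≤ (1 / 4) ^ l := by
    have h1 : Tendsto (fun L : ℕ => (Q : ℝ) ^ (2 * L + 1) / 2) atTop atTop :=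
      ((tendsto_pow_atTop_atTop_of_one_lt hQR).comp
        (tendsto_atTop_mono (fun L => by simp only [id_eq]; omega) tendsto_id)).atTop_div_const (by norm_num)
    exact ((tendsto_gaussian_tail.comp h1).eventually_le_const (by positivity)).exists
  set γ := (1 - 3 / (l : ℝ)) * β with hγ
  have hγ0 : 0 < γ := (mul_pos he hq0).trans hl
  have hgap : 0 < γ / (4 * q) - e / 4 := by
    rw [sub_pos, lt_div_iff₀ (by positivity)]
    linarith
  refine AchievesDoF.of_eventually ?_
  have hlarge : Tendsto (fun P : ℝ => (γ / (4 * q) - e / 4) * Real.log P) atTop atTop :=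
    Real.tendsto_log_atTop.const_mul_atTop hgap
  -- The surplus slope `hgap` eventually pays the bounded losses: the unused low positions, the
  -- rounding of `N`, and `log 2`.
  filter_upwards [hlarge.eventually_ge_atTop (γ * (L + 2) + Real.log 2), eventually_gt_atTop 1,
    Real.tendsto_log_atTop.eventually_ge_atTop (4 * q * (L + 1))] with P hP hP1 hP2
  have hlogP : 0 < Real.log P := Real.log_pos hP1
  have hfl : L + 1 ≤ ⌊Real.log P / (4 * q)⌋₊ := by
    refine Nat.le_floor ?_
    rw [le_div_iff₀ (by positivity)]
    push_cast
    linarith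
  obtain ⟨N, hN⟩ := Nat.exists_eq_add_of_le hfl
  have hN1 : Real.log P / (4 * q) < L + 2 + N := by
    have := Nat.lt_floor_add_one (Real.log P / (4 * q))
    rw [hN] at this
    push_cast at this
    linarith
  have hN2 : ((L + 1 + N : ℕ) : ℝ) ≤ Real.log P / (4 * q) := by
    rw [← hN]
    exact Nat.floor_le (by positivity)
  have hpow : (Q : ℝ) ^ (4 * (L + 1 + N)) ≤ P := by
    rw [← Real.log_le_log_iff (by positivity) (by linarith), Real.log_pow]
    rw [le_div_iff₀ (by positivity)] at hN2
    push_cast at hN2 ⊢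
    linarith
  have hrate : e / 4 * Real.log P ≤ (1 - 3 / (l : ℝ)) * (N * β) - Real.log 2 := by
    have h1 : γ * (Real.log P / (4 * q)) ≤ γ * (L + 2 + N) :=
      mul_le_mul_of_nonneg_left hN1.le hγ0.le
    have h2 : (1 - 3 / (l : ℝ)) * (N * β) = γ * N := by rw [hγ]; ring
    have h3 : (γ / (4 * q) - e / 4) * Real.log P =
      γ * (Real.log P / (4 * q)) - e / 4 * Real.log P := by ring
    rw [h2]
    linarith
  refine ⟨_, alignmentChannel_isAchievable hb hl0 hL hpow
    ((by positivity : 0 ≤ e / 4 * Real.log P).trans hrate), ?_⟩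
  rw [Finset.sum_const, Finset.card_univ, Fintype.card_fin, nsmul_eq_mul]
  have := mul_le_mul_of_nonneg_left hrate (Nat.cast_nonneg (α := ℝ) K)
  linarith

theorem alignmentChannel_isFullyConnected {K Q : ℕ} (hQ : Q ≠ 0) :
    IsFullyConnected (alignmentChannel K Q) := by
  intro k j
  unfold alignmentChannel
  split_ifs <;> simp [hQ]

theorem alignmentChannel_achieves {K Q : ℕ} (hK : 1 ≤ K) {ε : ℝ} (hε : 0 < ε) (hKQ : K ∣ Q)
    (hQ : (K : ℝ) ^ (1 / ε) < (Q : ℝ)) :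
    1 < Q ∧ 0 < Q / K ∧
      AchievesDoF (alignmentChannel K Q) (evenDigitSignals K Q) ((K : ℝ) / 2 * (1 - ε)) := by
  have hKR : (1 : ℝ) ≤ K := by exact_mod_cast hK
  have hQ1R : (1 : ℝ) < Q := (Real.one_le_rpow hKR (by positivity)).trans_lt hQ
  have hQ1 : 1 < Q := by exact_mod_cast hQ1R
  have hb : 0 < Q / K := Nat.div_pos (Nat.le_of_dvd (by omega) hKQ) hK
  refine ⟨hQ1, hb, ?_⟩
  -- For `1 ≤ ε` the target is nonpositive and zero rates suffice; otherwise `1 - ε` is positive.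
  rcases le_or_gt 1 ε with h1 | h1
  · have h0 : (0 : ℝ) ∈ evenDigitSignals K Q := ⟨0, fun _ => 0, fun _ => hb, by simp⟩
    refine achievesDoF_of_nonpos _ h0 ?_
    exact mul_nonpos_of_nonneg_of_nonpos (by positivity) (by linarith)
  · refine alignmentChannel_achievesDoF hb hQ1 (by linarith) ?_
    have hlog := Real.log_lt_log (by positivity) hQ
    rw [Real.log_rpow (by linarith), one_div, inv_mul_lt_iff₀ hε] at hlog
    rw [Nat.cast_div hKQ (by positivity), Real.log_div (by positivity) (by positivity)]
    linarith

theorem theorem1 (K : ℕ) (hK : 1 ≤ K) (ε : ℝ) (hε : 0 < ε) :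
    (∃ H : Matrix (Fin K) (Fin K) ℝ,
      IsFullyConnected H ∧ AchievesDoF H Set.univ ((K : ℝ) / 2 * (1 - ε))) ∧
    ∀ Q : ℕ, K ∣ Q → (K : ℝ) ^ (1 / ε) < (Q : ℝ) →
      IsFullyConnected (alignmentChannel K Q) ∧
      AchievesDoF (alignmentChannel K Q) Set.univ ((K : ℝ) / 2 * (1 - ε)) ∧
      AchievesDoF (alignmentChannel K Q) (evenDigitSignals K Q) ((K : ℝ) / 2 * (1 - ε)) ∧
      ∀ x : Fin K → ℝ, (∀ j, x j ∈ evenDigitSignals K Q) →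
        ∀ k, ∑ j ∈ Finset.univ.erase k, alignmentChannel K Q k j * x j ∈ oddDigitSignals Q := by
  refine ⟨?_, fun Q hKQ hQ => ?_⟩
  · obtain ⟨m, hm⟩ := exists_nat_gt ((K : ℝ) ^ (1 / ε))
    have hQ : (K : ℝ) ^ (1 / ε) < ((K * m : ℕ) : ℝ) :=
      hm.trans_le (by exact_mod_cast Nat.le_mul_of_pos_left m hK)
    obtain ⟨hQ1, -, h⟩ := alignmentChannel_achieves hK hε (dvd_mul_right K m) hQ
    exact ⟨alignmentChannel K (K * m), alignmentChannel_isFullyConnected (by omega),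
      h.mono (Set.subset_univ _)⟩
  · obtain ⟨hQ1, hb, h⟩ := alignmentChannel_achieves hK hε hKQ hQ
    exact ⟨alignmentChannel_isFullyConnected (by omega), h.mono (Set.subset_univ _), h,
      interference_mem_oddDigitSignals hb⟩
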